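/- Fix $n\ge 0$ and propositional variables $p_1,\dots,p_n$. Formulas are built from $p_1,\dots,p_n,\bot,\top$ with $\wedge,\vee,\to$; a $(\wedge,\to)$-formula is one built from $p_1,\dots,p_n,\top$ with $\wedge,\to$ only. Let $F_{\wedge,\to}(n)$ be the set of $(\wedge,\to)$-formulas modulo provable equivalence in intuitionistic propositional logic (IPC), ordered by $\varphi\le\psi$ iff $\psi$ is provable from $\varphi$ in IPC. For $(\wedge,\to)$-formulas $\varphi,\psi$ put $\varphi\veebar\psi:=\bigwedge\{\chi\in F_{\wedge,\to}(n) : \varphi\le\chi\text{ and }\psi\le\chi\}$, the conjunction taking one representative of each class. For a formula $\varphi$, let $s(\varphi)$ be the $(\wedge,\to)$-formula obtained from $\varphi$ by replacing each occurrence of $\vee$ by $\veebar$ and each occurrence of $\bot$ by $p_1\wedge\dots\wedge p_n$. A model is a partially ordered set $(M,\le)$ with an order-preserving map $c:M\to 2^n$. Satisfaction is defined by: $M,x\models p_i$ iff $c(x)_i=1$; never $M,x\models\bot$; always $M,x\models\top$; $\wedge$ and $\vee$ are interpreted pointwise; and $M,x\models\varphi\to\psi$ iff for all $y\ge x$, $M,y\models\varphi$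 implies $M,y\models\psi$. A point $x$ of $M$ is separated if there is $q\in\{p_1,\dots,p_n\}$ such that $M,x\not\models q$ while $M,y\models q$ for all $y>x$. Let $M^s$ be the model formed by the separated points of $M$ with the restricted order and colouring. Theorem. The set $F_{\wedge,\to}(n)$ is finite (so $\veebar$ and $s$ are well defined), and for every formula $\varphi$, every model $M$ and every separated point $x$ of $M$, $$M^s,x\models\varphi\iff M^s,x\models s(\varphi).$$ -/

import Mathlib

namespace IPC

/-- Formulas of intuitionistic propositional logic over the variables `p_0, …, p_{n-1}`. -/
inductive Form (n : ℕ) : Type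
  | var (i : Fin n) : Form n
  | bot : Form n
  | top : Form n
  | and (φ ψ : Form n) : Form n
  | or (φ ψ : Form n) : Form n
  | imp (φ ψ : Form n) : Form n

/-- Natural deduction for IPC: `Prov Γ φ` says that `φ` is derivable from the assumptions `Γ`. -/
inductive Prov {n : ℕ} : Set (Form n) → Form n → Prop
  | ax {Γ : Set (Form n)} {φ : Form n} : φ ∈ Γ → Prov Γ φ
  | topI {Γ : Set (Form n)} : Prov Γ Form.top
  | botE {Γ : Set (Form n)} {φ : Form n} : Prov Γ Form.bot → Prov Γ φ
  | andI {Γ : Set (Form n)} {φ ψ : Form n} : Prov Γ φ → Prov Γ ψ → Prov Γ (Form.and φ ψ)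
  | andE₁ {Γ : Set (Form n)} {φ ψ : Form n} : Prov Γ (Form.and φ ψ) → Prov Γ φ
  | andE₂ {Γ : Set (Form n)} {φ ψ : Form n} : Prov Γ (Form.and φ ψ) → Prov Γ ψ
  | orI₁ {Γ : Set (Form n)} {φ ψ : Form n} : Prov Γ φ → Prov Γ (Form.or φ ψ)
  | orI₂ {Γ : Set (Form n)} {φ ψ : Form n} : Prov Γ ψ → Prov Γ (Form.or φ ψ)
  | orE {Γ : Set (Form n)} {φ ψ χ : Form n} : Prov Γ (Form.or φ ψ) →
      Prov (insert φ Γ) χ → Prov (insert ψ Γ) χ → Prov Γ χ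
  | impI {Γ : Set (Form n)} {φ ψ : Form n} : Prov (insert φ Γ) ψ → Prov Γ (Form.imp φ ψ)
  | impE {Γ : Set (Form n)} {φ ψ : Form n} : Prov Γ (Form.imp φ ψ) → Prov Γ φ → Prov Γ ψ

theorem Prov.mono {n : ℕ} {Γ Δ : Set (Form n)} {φ : Form n} (h : Prov Γ φ) (hs : Γ ⊆ Δ) :
    Prov Δ φ := by
  induction h generalizing Δ with
  | ax h => exact .ax (hs h)
  | topI => exact .topI
  | botE _ ih => exact .botE (ih hs)
  | andI _ _ ih₁ ih₂ => exact .andI (ih₁ hs) (ih₂ hs)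
  | andE₁ _ ih => exact .andE₁ (ih hs)
  | andE₂ _ ih => exact .andE₂ (ih hs)
  | orI₁ _ ih => exact .orI₁ (ih hs)
  | orI₂ _ ih => exact .orI₂ (ih hs)
  | orE _ _ _ ih ih₁ ih₂ =>
      exact .orE (ih hs) (ih₁ (Set.insert_subset_insert hs)) (ih₂ (Set.insert_subset_insert hs))
  | impI _ ih => exact .impI (ih (Set.insert_subset_insert hs))
  | impE _ _ ih₁ ih₂ => exact .impE (ih₁ hs) (ih₂ hs)

/-- `(∧,→)`-formulas. The top element belongs to the fragment (it is `p → p` as soon as there is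
a variable `p`). -/
inductive MIForm (n : ℕ) : Type
  | var (i : Fin n) : MIForm n
  | top : MIForm n
  | and (α β : MIForm n) : MIForm n
  | imp (α β : MIForm n) : MIForm n

/-- The inclusion of the `(∧,→)`-formulas among all formulas. -/
def MIForm.toForm {n : ℕ} : MIForm n → Form n
  | .var i => .var i
  | .top => .top
  | .and α β => .and α.toForm β.toForm
  | .imp α β => .imp α.toForm β.toForm

/-- The `(∧,→)`-formulas, preordered by provable entailment in IPC. -/
instance MIForm.instPreorder (n : ℕ) : Preorder (MIForm n) where
  le α β := Prov {α.toForm} β.toForm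
  le_refl _ := .ax rfl
  le_trans _ _ _ h₁ h₂ :=
    .impE (.impI (h₂.mono (Set.singleton_subset_iff.2 (Set.mem_insert _ _)))) h₁

/-- `F_{∧,→}(n)`: the `(∧,→)`-formulas up to provable equivalence in IPC, a partial order. -/
abbrev FMI (n : ℕ) : Type := Antisymmetrization (MIForm n) (· ≤ ·)

/-- The conjunction of a list of `(∧,→)`-formulas. -/
def MIForm.conj {n : ℕ} (l : List (MIForm n)) : MIForm n := l.foldr MIForm.and MIForm.top

/-- `p_0 ∧ ⋯ ∧ p_{n-1}`. -/
def MIForm.sbot (n : ℕ) : MIForm n := MIForm.conj (List.ofFn MIForm.var)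

/-- The elements of `F_{∧,→}(n)` that are above both `α` and `β`. -/
def MIForm.upper {n : ℕ} (α β : MIForm n) : Set (FMI n) :=
  {χ | toAntisymmetrization (· ≤ ·) α ≤ χ ∧ toAntisymmetrization (· ≤ ·) β ≤ χ}

open Classical in
/-- The join of `α` and `β` in `F_{∧,→}(n)`: the conjunction of all `χ` in `F_{∧,→}(n)` with
`α ≤ χ` and `β ≤ χ`, one representative being taken of each class `χ`. This makes sense as
`F_{∧,→}(n)` is finite; the value in the `else` branch has no meaning. -/
noncomputable def MIForm.sor {n : ℕ} (α β : MIForm n) : MIForm n :=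
  if h : (MIForm.upper α β).Finite then
    MIForm.conj (h.toFinset.toList.map (ofAntisymmetrization (· ≤ ·)))
  else MIForm.top

/-- The `(∧,→)`-translation: replace every disjunction by the join of `F_{∧,→}(n)` and every `⊥`
by `p_0 ∧ ⋯ ∧ p_{n-1}`. -/
noncomputable def s {n : ℕ} : Form n → MIForm n
  | .var i => .var i
  | .bot => MIForm.sbot n
  | .top => .top
  | .and φ ψ => .and (s φ) (s ψ)
  | .or φ ψ => MIForm.sor (s φ) (s ψ)
  | .imp φ ψ => .imp (s φ) (s ψ)

/-- A colouring of the poset `W`, i.e. an order-preserving map to `2^n`. A model is a poset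
together with a colouring. -/
abbrev Colouring (n : ℕ) (W : Type*) [PartialOrder W] := W →o (Fin n → Bool)

/-- Satisfaction in the model `(W, ≤, c)`. -/
def Sat {n : ℕ} {W : Type*} [PartialOrder W] (c : Colouring n W) : W → Form n → Prop
  | x, .var i => c x i = true
  | _, .bot => False
  | _, .top => True
  | x, .and φ ψ => Sat c x φ ∧ Sat c x ψ
  | x, .or φ ψ => Sat c x φ ∨ Sat c x ψ
  | x, .imp φ ψ => ∀ y, x ≤ y → Sat c y φ → Sat c y ψ

/-- `x` is a `φ`-border point: it does not satisfy `φ`, but all its proper successors do. -/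
def IsBorderPoint {n : ℕ} {W : Type*} [PartialOrder W] (c : Colouring n W) (φ : Form n) (x : W) :
    Prop :=
  ¬ Sat c x φ ∧ ∀ y, x < y → Sat c y φ

/-- `x` is separated: it is a `q`-border point for some variable `q`. -/
def IsSeparated {n : ℕ} {W : Type*} [PartialOrder W] (c : Colouring n W) (x : W) : Prop :=
  ∃ q : Fin n, IsBorderPoint c (.var q) x

/-- The poset underlying `M^s`: the separated points, with the restricted order. -/
abbrev SepPoints {n : ℕ} {W : Type*} [PartialOrder W] (c : Colouring n W) :=
  {x : W // IsSeparated c x}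

/-- The colouring of `M^s`: the restriction of the colouring of `M`. -/
def sepColouring {n : ℕ} {W : Type*} [PartialOrder W] (c : Colouring n W) :
    Colouring n (SepPoints c) :=
  c.comp (OrderHom.Subtype.val _)

end IPC

namespace IPC

/-! ### Soundness for Kripke models. -/

section Semantics

variable {n : ℕ} {W : Type*} [PartialOrder W] (c : Colouring n W)

/-! Finiteness: a theory maximal among those omitting `ψ` is maximal among those omitting some
variable (`MaxOmits.exists_var`), so such theories, the points, separate inequivalent formulas. A
point is determined by its variables and its proper successors, which have strictly more variables;
hence there are finitely many.

Translation: let `x` be a `q`-border point where `α` and `β` fail. Then `α → q` and `β → q` hold at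
`x` but `q` does not, so the upper bound `(α → q) → (β → q) → q` fails, and with it the join. `⊥` is
harmless since every separated point omits a variable. Points of `M^s` stay separated in `M^s`, so
induction on formulas applies. -/

theorem Sat.mono {φ : Form n} {x y : W} (hxy : x ≤ y) (h : Sat c x φ) : Sat c y φ := by
  induction φ with
  | var i =>
      have hle : c x i ≤ c y i := c.monotone hxy i
      have hx : c x i = true := h
      rw [hx] at hle
      exact top_le_iff.1 hle
  | bot => exact h
  | top => trivial
  | and φ ψ ihφ ihψ => exact ⟨ihφ h.1, ihψ h.2⟩
  | or φ ψ ihφ ihψ => exact h.imp ihφ ihψ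
  | imp φ ψ _ _ => exact fun z hz => h z (hxy.trans hz)

theorem Prov.sound {Γ : Set (Form n)} {φ : Form n} (h : Prov Γ φ) {x : W}
    (hΓ : ∀ γ ∈ Γ, Sat c x γ) : Sat c x φ := by
  induction h generalizing x with
  | ax h => exact hΓ _ h
  | topI => trivial
  | botE _ ih => exact (ih hΓ).elim
  | andI _ _ ih₁ ih₂ => exact ⟨ih₁ hΓ, ih₂ hΓ⟩
  | andE₁ _ ih => exact (ih hΓ).1
  | andE₂ _ ih => exact (ih hΓ).2
  | orI₁ _ ih => exact Or.inl (ih hΓ)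
  | orI₂ _ ih => exact Or.inr (ih hΓ)
  | orE _ _ _ ih ih₁ ih₂ =>
      rcases ih hΓ with h | h
      · exact ih₁ (Set.forall_mem_insert.2 ⟨h, hΓ⟩)
      · exact ih₂ (Set.forall_mem_insert.2 ⟨h, hΓ⟩)
  | impI _ ih =>
      exact fun y hy h => ih (Set.forall_mem_insert.2 ⟨h, fun γ hγ => (hΓ γ hγ).mono c hy⟩)
  | impE _ _ ih₁ ih₂ => exact ih₁ hΓ x le_rfl (ih₂ hΓ)

theorem sat_of_le {α β : MIForm n} (h : α ≤ β) {x : W} (hα : Sat c x α.toForm) :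
    Sat c x β.toForm :=
  Prov.sound c h fun _ hγ => hγ ▸ hα

theorem sat_conj {x : W} (l : List (MIForm n)) :
    Sat c x (MIForm.conj l).toForm ↔ ∀ α ∈ l, Sat c x α.toForm := by
  induction l with
  | nil => simp [MIForm.conj, MIForm.toForm, Sat]
  | cons α l ih =>
      rw [List.forall_mem_cons, ← ih]
      rfl

theorem sat_sbot {x : W} : Sat c x (MIForm.sbot n).toForm ↔ ∀ i, Sat c x (.var i) := by
  rw [MIForm.sbot, sat_conj, List.forall_mem_ofFn_iff]
  rfl

end Semantics

/-! ### Canonical points and finiteness of the fragment. -/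

namespace MIForm

variable {n : ℕ}

theorem prov_of_le {Γ : Set (Form n)} {α β : MIForm n} (h : α ≤ β) (hα : Prov Γ α.toForm) :
    Prov Γ β.toForm :=
  .impE (.impI (Prov.mono h (Set.singleton_subset_iff.2 (Set.mem_insert _ _)))) hα

theorem le_top' (α : MIForm n) : α ≤ top := Prov.topI

theorem and_le_left (α β : MIForm n) : and α β ≤ α := .andE₁ (.ax rfl)

theorem and_le_right (α β : MIForm n) : and α β ≤ β := .andE₂ (.ax rfl)

theorem le_and {α β γ : MIForm n} (h₁ : γ ≤ α) (h₂ : γ ≤ β) : γ ≤ and α β := .andI h₁ h₂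

theorem le_imp_iff {α β γ : MIForm n} : γ ≤ imp α β ↔ and γ α ≤ β := by
  constructor
  · intro h
    exact .impE (prov_of_le h (.andE₁ (.ax rfl))) (.andE₂ (.ax rfl))
  · intro h
    refine .impI (prov_of_le h (.andI (.ax ?_) (.ax ?_)))
    · exact Set.mem_insert_of_mem _ rfl
    · exact Set.mem_insert _ _

theorem imp_and_le (α β : MIForm n) : and (imp α β) α ≤ β := le_imp_iff.1 le_rfl

/-- `(α → q) → (β → q) → q`, an upper bound of `α` and `β` in the `(∧,→)`-fragment. -/
def weakOr (α β q : MIForm n) : MIForm n := imp (imp α q) (imp (imp β q) q)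

theorem le_weakOr_left (α β q : MIForm n) : α ≤ weakOr α β q := by
  refine le_imp_iff.2 (le_imp_iff.2 ((and_le_left _ _).trans ?_))
  exact (le_and (and_le_right _ _) (and_le_left _ _)).trans (imp_and_le α q)

theorem le_weakOr_right (α β q : MIForm n) : β ≤ weakOr α β q := by
  refine le_imp_iff.2 (le_imp_iff.2 (le_trans ?_ (imp_and_le β q)))
  exact le_and (and_le_right _ _) ((and_le_left _ _).trans (and_le_left _ _))

/-- Sets of `(∧,→)`-formulas that are closed under finite conjunctions and entailment. -/
structure IsTheory (T : Set (MIForm n)) : Prop where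
  top_mem : top ∈ T
  and_mem : ∀ {α β}, α ∈ T → β ∈ T → and α β ∈ T
  mem_of_le : ∀ {α β}, α ≤ β → α ∈ T → β ∈ T

theorem IsTheory.mp {T : Set (MIForm n)} (hT : IsTheory T) {α β : MIForm n}
    (h : imp α β ∈ T) (hα : α ∈ T) : β ∈ T :=
  hT.mem_of_le (imp_and_le α β) (hT.and_mem h hα)

theorem isTheory_Ici (α : MIForm n) : IsTheory (Set.Ici α) where
  top_mem := le_top' α
  and_mem := le_and
  mem_of_le h hα := le_trans hα h

/-- The theory generated by `T` and `α`. -/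
def adjoin (T : Set (MIForm n)) (α : MIForm n) : Set (MIForm n) := {γ | imp α γ ∈ T}

theorem IsTheory.adjoin {T : Set (MIForm n)} (hT : IsTheory T) (α : MIForm n) :
    IsTheory (adjoin T α) where
  top_mem := hT.mem_of_le (le_imp_iff.2 (le_top' _)) hT.top_mem
  and_mem {β γ} hβ hγ := by
    refine hT.mem_of_le (le_imp_iff.2 (le_and ?_ ?_)) (hT.and_mem hβ hγ)
    · exact (le_and ((and_le_left _ _).trans (and_le_left _ _)) (and_le_right _ _)).trans
        (imp_and_le α β)
    · exact (le_and ((and_le_left _ _).trans (and_le_right _ _)) (and_le_right _ _)).trans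
        (imp_and_le α γ)
  mem_of_le {β γ} h hβ := hT.mem_of_le (le_imp_iff.2 ((imp_and_le α β).trans h)) hβ

theorem IsTheory.subset_adjoin {T : Set (MIForm n)} (hT : IsTheory T) (α : MIForm n) :
    T ⊆ MIForm.adjoin T α :=
  fun _ hγ => hT.mem_of_le (le_imp_iff.2 (and_le_left _ _)) hγ

theorem IsTheory.mem_adjoin_self {T : Set (MIForm n)} (hT : IsTheory T) (α : MIForm n) :
    α ∈ MIForm.adjoin T α :=
  hT.mem_of_le (le_imp_iff.2 (and_le_right _ _)) hT.top_mem

/-- `T` is a maximal theory among those that do not contain `ψ`. -/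
def MaxOmits (ψ : MIForm n) (T : Set (MIForm n)) : Prop :=
  Maximal (fun T => IsTheory T ∧ ψ ∉ T) T

theorem IsTheory.exists_maxOmits {T : Set (MIForm n)} (hT : IsTheory T) {ψ : MIForm n}
    (hψ : ψ ∉ T) : ∃ G, T ⊆ G ∧ MaxOmits ψ G := by
  refine zorn_subset_nonempty {T | IsTheory T ∧ ψ ∉ T} ?_ T ⟨hT, hψ⟩
  intro C hC hchain ⟨U, hU⟩
  refine ⟨⋃₀ C, ⟨⟨⟨U, hU, (hC hU).1.top_mem⟩, ?_, ?_⟩, ?_⟩, fun V hV => Set.subset_sUnion_of_mem hV⟩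
  · rintro α β ⟨A, hA, hαA⟩ ⟨B, hB, hβB⟩
    rcases hchain.total hA hB with h | h
    · exact ⟨B, hB, (hC hB).1.and_mem (h hαA) hβB⟩
    · exact ⟨A, hA, (hC hA).1.and_mem hαA (h hβB)⟩
  · rintro α β hαβ ⟨A, hA, hαA⟩
    exact ⟨A, hA, (hC hA).1.mem_of_le hαβ hαA⟩
  · rintro ⟨A, hA, hψA⟩
    exact (hC hA).2 hψA

theorem MaxOmits.of_forall {ψ χ : MIForm n} {T : Set (MIForm n)} (h : MaxOmits ψ T)
    (hχ : χ ∉ T) (H : ∀ U, IsTheory U → T ⊆ U → ψ ∈ U → χ ∈ U) : MaxOmits χ T := by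
  refine ⟨⟨h.prop.1, hχ⟩, fun U hU hTU => h.le_of_ge ⟨hU.1, fun hψ => ?_⟩ hTU⟩
  exact hU.2 (H U hU.1 hTU hψ)

/-- Without `∨` and `⊥`, the omitted formula can be replaced by one of its subformulas: an omitted
conjunct, or the conclusion of an implication. -/
theorem MaxOmits.exists_var {ψ : MIForm n} {T : Set (MIForm n)} (h : MaxOmits ψ T) :
    ∃ q, MaxOmits (var q) T := by
  induction ψ with
  | var q => exact ⟨q, h⟩
  | top => exact (h.prop.2 h.prop.1.top_mem).elim
  | and α β ihα ihβ =>
      by_cases hα : α ∈ T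
      · exact ihβ (h.of_forall (fun hβ => h.prop.2 (h.prop.1.and_mem hα hβ))
          fun U hU _ => hU.mem_of_le (and_le_right _ _))
      · exact ihα (h.of_forall hα fun U hU _ => hU.mem_of_le (and_le_left _ _))
  | imp α β _ ihβ =>
      have hT := h.prop.1
      -- `α` and `α → β` give `β`, so adjoining `α` still omits `α → β`; maximality applies.
      have hα : α ∈ T := by
        refine h.le_of_ge ⟨hT.adjoin α, fun hmem => h.prop.2 ?_⟩ (hT.subset_adjoin α)
          (hT.mem_adjoin_self α)
        exact (hT.adjoin α).mp hmem (hT.mem_adjoin_self α)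
      refine ihβ (h.of_forall (fun hβ => h.prop.2 ?_) fun U hU hTU hψ => hU.mp hψ (hTU hα))
      exact hT.mem_of_le (le_imp_iff.2 (and_le_left _ _)) hβ

/-- The points of the canonical model: theories maximal among those omitting some variable. -/
abbrev Point (n : ℕ) : Type := {T : Set (MIForm n) // ∃ q, MaxOmits (var q) T}

theorem Point.isTheory (G : Point n) : IsTheory G.1 :=
  let ⟨_, hq⟩ := G.2
  hq.prop.1

theorem IsTheory.exists_point {T : Set (MIForm n)} (hT : IsTheory T) {ψ : MIForm n}
    (hψ : ψ ∉ T) : ∃ G : Point n, T ⊆ G.1 ∧ ψ ∉ G.1 :=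
  let ⟨G, hTG, hG⟩ := hT.exists_maxOmits hψ
  ⟨⟨G, hG.exists_var⟩, hTG, hG.prop.2⟩

theorem Point.imp_mem_iff {G : Point n} {α β : MIForm n} :
    imp α β ∈ G.1 ↔ (α ∈ G.1 → β ∈ G.1) ∧ ∀ H : Point n, G < H → α ∈ H.1 → β ∈ H.1 := by
  constructor
  · intro h
    exact ⟨G.isTheory.mp h, fun H hH => H.isTheory.mp (hH.le h)⟩
  · rintro ⟨h₁, h₂⟩
    by_contra h
    obtain ⟨H, hGH, hβ⟩ := (G.isTheory.adjoin α).exists_point (ψ := β) h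
    have hα : α ∈ H.1 := hGH (G.isTheory.mem_adjoin_self α)
    have hle : G ≤ H := (G.isTheory.subset_adjoin α).trans hGH
    rcases hle.eq_or_lt with rfl | hlt
    · exact hβ (h₁ hα)
    · exact hβ (h₂ H hlt hα)

/-- The variables belonging to a point. -/
def Point.vars (G : Point n) : Set (Fin n) := {i | var i ∈ G.1}

theorem Point.ext_of_vars_Ioi {G H : Point n} (hvars : G.vars = H.vars)
    (hIoi : Set.Ioi G = Set.Ioi H) : G = H := by
  refine Subtype.ext (Set.ext fun α => ?_)
  induction α with
  | var i => exact Set.ext_iff.1 hvars i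
  | top => exact iff_of_true G.isTheory.top_mem H.isTheory.top_mem
  | and α β ihα ihβ =>
      have key (K : Point n) : and α β ∈ K.1 ↔ α ∈ K.1 ∧ β ∈ K.1 :=
        ⟨fun h => ⟨K.isTheory.mem_of_le (and_le_left _ _) h,
          K.isTheory.mem_of_le (and_le_right _ _) h⟩, fun h => K.isTheory.and_mem h.1 h.2⟩
      rw [key, key, ihα, ihβ]
  | imp α β ihα ihβ =>
      have key (K : Point n) : G < K ↔ H < K := Set.ext_iff.1 hIoi K
      simp only [imp_mem_iff, ihα, ihβ, key]

/-- A larger theory with no new variables would still omit `q`, against maximality. -/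
theorem Point.vars_strictMono : StrictMono (Point.vars (n := n)) := by
  intro G H hGH
  obtain ⟨q, hq⟩ := G.2
  refine ssubset_of_subset_not_subset (fun i hi => hGH.le hi) fun hsub => ?_
  have hqH : var q ∉ H.1 := fun h => hq.prop.2 (hsub h)
  exact hGH.not_ge (hq.le_of_ge ⟨H.isTheory, hqH⟩ hGH.le)

/-- Downward induction on `S`: points whose variables are exactly `S` are told apart by their sets
of proper successors, all drawn from a set already known to be finite. -/
theorem Point.finite_setOf_vars_superset (S : Set (Fin n)) :
    {G : Point n | S ≤ G.vars}.Finite := by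
  induction S using WellFoundedGT.induction with
  | ind S ih =>
      have hgt : {G : Point n | S < G.vars}.Finite := by
        refine (Set.Finite.biUnion (Set.toFinite {U : Set (Fin n) | S < U})
          (t := fun U => {G : Point n | U ≤ G.vars}) ih).subset fun G hG => ?_
        exact Set.mem_biUnion (x := G.vars) hG (le_refl G.vars)
      have heq : {G : Point n | G.vars = S}.Finite := by
        refine Set.Finite.of_finite_image (f := fun G : Point n => Set.Ioi G)
          (hgt.finite_subsets.subset ?_) ?_
        · rintro _ ⟨G, rfl, rfl⟩ H hH
          exact vars_strictMono hH
        · intro G hG H hH h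
          exact ext_of_vars_Ioi (Eq.trans hG (Eq.symm hH)) h
      refine (hgt.union heq).subset fun G hG => ?_
      rcases eq_or_lt_of_le (show S ≤ G.vars from hG) with h | h
      · exact Or.inr h.symm
      · exact Or.inl h

instance Point.instFinite : Finite (Point n) :=
  Set.finite_univ_iff.1 ((finite_setOf_vars_superset ∅).subset fun G _ => Set.empty_subset G.vars)

theorem le_of_forall_point {α β : MIForm n} (h : ∀ G : Point n, α ∈ G.1 → β ∈ G.1) : α ≤ β := by
  by_contra hαβ
  obtain ⟨G, hG, hβ⟩ := (isTheory_Ici α).exists_point hαβ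
  exact hβ (h G (hG (le_refl α)))

end MIForm

/-- Finitely generated free implicative semilattices are finite. -/
instance FMI.instFinite (n : ℕ) : Finite (FMI n) := by
  refine Finite.of_injective
    (fun a : FMI n => {G : MIForm.Point n | ofAntisymmetrization (· ≤ ·) a ∈ G.1}) fun a b h => ?_
  rw [← toAntisymmetrization_ofAntisymmetrization (· ≤ ·) a,
    ← toAntisymmetrization_ofAntisymmetrization (· ≤ ·) b]
  exact Quotient.sound ⟨MIForm.le_of_forall_point fun G => (Set.ext_iff.1 h G).1,
    MIForm.le_of_forall_point fun G => (Set.ext_iff.1 h G).2⟩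

/-! ### The translation at separated points. -/

section Translation

variable {n : ℕ} {W : Type*} [PartialOrder W] (c : Colouring n W)

theorem sat_sor {α β : MIForm n} {x : W} :
    Sat c x (MIForm.sor α β).toForm ↔ ∀ χ : MIForm n, α ≤ χ → β ≤ χ → Sat c x χ.toForm := by
  rw [MIForm.sor, dif_pos (Set.toFinite _), sat_conj]
  simp only [List.forall_mem_map, Finset.mem_toList, Set.Finite.mem_toFinset]
  constructor
  · intro h χ hα hβ
    exact sat_of_le c (toAntisymmetrization_le_toAntisymmetrization_iff.1
      (toAntisymmetrization_ofAntisymmetrization (· ≤ ·) _).le)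
      (h (toAntisymmetrization (· ≤ ·) χ) ⟨hα, hβ⟩)
  · rintro h χ ⟨hα, hβ⟩
    rw [← toAntisymmetrization_ofAntisymmetrization (· ≤ ·) χ] at hα hβ
    exact h _ hα hβ

theorem sat_sor_of_isSeparated {x : W} (hx : IsSeparated c x) {α β : MIForm n} :
    Sat c x (MIForm.sor α β).toForm ↔ Sat c x α.toForm ∨ Sat c x β.toForm := by
  rw [sat_sor]
  constructor
  · intro h
    by_contra! hαβ
    obtain ⟨q, hq, hlt⟩ := hx
    have key {γ : MIForm n} (hγ : ¬ Sat c x γ.toForm) :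
        Sat c x (MIForm.imp γ (.var q)).toForm := by
      -- At `x` itself `γ` fails; strictly above `x`, `q` holds.
      intro y hy hγy
      rcases hy.eq_or_lt with rfl | hy
      · exact (hγ hγy).elim
      · exact hlt y hy
    exact hq (h _ (MIForm.le_weakOr_left α β (.var q)) (MIForm.le_weakOr_right α β (.var q))
      x le_rfl (key hαβ.1) x le_rfl (key hαβ.2))
  · rintro (h | h) χ hα hβ
    · exact sat_of_le c hα h
    · exact sat_of_le c hβ h

theorem sat_iff_sat_s (hc : ∀ x, IsSeparated c x) (φ : Form n) (x : W) :
    Sat c x φ ↔ Sat c x (s φ).toForm := by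
  induction φ generalizing x with
  | var i => rfl
  | bot =>
      obtain ⟨q, hq, -⟩ := hc x
      exact iff_of_false id fun h => hq ((sat_sbot c).1 h q)
  | top => rfl
  | and φ ψ ihφ ihψ => exact and_congr (ihφ x) (ihψ x)
  | or φ ψ ihφ ihψ => exact (or_congr (ihφ x) (ihψ x)).trans (sat_sor_of_isSeparated c (hc x)).symm
  | imp φ ψ ihφ ihψ => exact forall₂_congr fun y _ => imp_congr (ihφ y) (ihψ y)

theorem isSeparated_sepColouring (x : SepPoints c) : IsSeparated (sepColouring c) x :=
  let ⟨q, hq, hlt⟩ := x.2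
  ⟨q, hq, fun y hy => hlt y.1 hy⟩

end Translation

end IPC

theorem theorem3p13 (n : ℕ) :
    Finite (IPC.FMI n) ∧
    ∀ (φ : IPC.Form n) (W : Type*) [PartialOrder W] (c : IPC.Colouring n W)
      (x : IPC.SepPoints c),
      IPC.Sat (IPC.sepColouring c) x φ ↔ IPC.Sat (IPC.sepColouring c) x (IPC.s φ).toForm :=
  ⟨inferInstance, fun φ _ _ c => IPC.sat_iff_sat_s _ (IPC.isSeparated_sepColouring c) φ⟩
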